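/- Let $p\in[0,1]$ and $C\in\mathbb{R}$. Consider the single-user age-of-information Markov decision process with states $(x,\lambda)\in\{1,2,\dots\}\times\{0,1\}$ ($x$ is the age of information at the user, $\lambda$ indicates whether a packet arrives in the current slot), actions $a\in\{0,1\}$ ($1$: update, $0$: idle), and the following dynamics: from $(x,\lambda)$ under action $a$ the next state is $(x',\lambda')$, where $x'=1$ if $a=\lambda=1$ and $x'=x+1$ otherwise, and $\lambda'$ is an independent Bernoulli variable with $P[\lambda'=1]=p$. The immediate cost is $$C\bigl((x,\lambda),a\bigr)=(x+1-x\,a\,\lambda)+C\,a .$$ The average cost of a (possibly history-dependent and randomized) policy $\mu$ with initial state $\mathbf{s}(0)$ is $$\limsup_{T\to\infty}\frac{1}{T+1}\,E_\mu\Bigl[\sum_{t=0}^{T}C(\mathbf{s}(t),a(t))\Bigr]\in[-\infty,\infty].$$ Then there exists a stationary deterministic policy that is cost-optimal independently of the initial state: one and the same stationary deterministic policy minimizes, for every initial state $\mathbf{s}(0)$, the average cost over all (history-dependent, randomized) policies. -/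

import Mathlib

namespace AgeMDP

/-- A state `(x, l)`: the age `x ≥ 1` at the user, and the indicator `l` of a packet arrival
in the current slot. -/
abbrev State := ℕ+ × Bool

/-- An action: `true` means "update the user", `false` means "idle". -/
abbrev Action := Bool

/-- The Bernoulli law of the arrival indicator: `true` with probability `p`. -/
noncomputable def arrival (p : unitInterval) : PMF Bool :=
  PMF.ofFintype (fun l => if l then ENNReal.ofReal (p : ℝ) else ENNReal.ofReal (1 - (p : ℝ))) (by
    have h0 : (0 : ℝ) ≤ p := p.2.1
    have h1 : (0 : ℝ) ≤ 1 - p := sub_nonneg.mpr p.2.2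
    simp [← ENNReal.ofReal_add h0 h1])

/-- The age in the next slot: `1` if a packet has arrived and the user is updated, and the current
age plus one otherwise. -/
def nextAge (s : State) (a : Action) : ℕ+ :=
  if s.2 = true ∧ a = true then 1 else s.1 + 1

/-- The transition law: the age moves to `nextAge s a`, and the arrival indicator is redrawn. -/
noncomputable def transition (p : unitInterval) (s : State) (a : Action) : PMF State :=
  (arrival p).map fun l => (nextAge s a, l)

/-- The immediate cost `(x + 1 - x * a * l) + C * a`. -/
def cost (C : ℝ) (s : State) (a : Action) : ℝ :=
  ((s.1 : ℝ) + 1 - (s.1 : ℝ) * (a.toNat : ℝ) * (s.2.toNat : ℝ)) + C * (a.toNat : ℝ)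

/-- The past of slot `t`: the list of the pairs `(s(i), a(i))`, `i < t`, most recent first.
Its length is `t`. -/
abbrev Past := List (State × Action)

/-- A policy, possibly history dependent and randomized: `μ h s` is the law of the action taken
in slot `h.length` when the past is `h` and the current state is `s`. -/
abbrev Policy := Past → State → PMF Action

/-- The law of the action depends on the current state only, neither on the slot nor on the
rest of the history. -/
def IsStationary (μ : Policy) : Prop :=
  ∀ (h₁ h₂ : Past) (s₁ s₂ : State), s₁ = s₂ → μ h₁ s₁ = μ h₂ s₂

/-- Every action is chosen with certainty. -/
def IsDeterministic (μ : Policy) : Prop :=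
  ∀ (h : Past) (s : State), ∃ a : Action, μ h s = PMF.pure a

/-- The joint law, under `μ` and with initial state `s₀`, of the past of slot `t` and of the
state in slot `t`. -/
noncomputable def law (p : unitInterval) (μ : Policy) (s₀ : State) : ℕ → PMF (Past × State)
  | 0 => PMF.pure ([], s₀)
  | t + 1 => (law p μ s₀ t).bind fun hs =>
      (μ hs.1 hs.2).bind fun a =>
        (transition p hs.2 a).map fun s' => ((hs.2, a) :: hs.1, s')

/-- The expectation, under `μ` and with initial state `s₀`, of the total cost incurred in the
slots `0, …, T`. The law charges finitely many points, so the sum is finite. -/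
noncomputable def expectedTotalCost (p : unitInterval) (C : ℝ) (μ : Policy) (s₀ : State)
    (T : ℕ) : ℝ :=
  ∑' hs : Past × State,
    (law p μ s₀ (T + 1) hs).toReal * (hs.1.map fun sa => cost C sa.1 sa.2).sum

/-- The average cost over the infinite horizon, as an extended real number. -/
noncomputable def averageCost (p : unitInterval) (C : ℝ) (μ : Policy) (s₀ : State) : EReal :=
  Filter.limsup
    (fun T : ℕ => ((1 / ((T : ℝ) + 1) * expectedTotalCost p C μ s₀ T : ℝ) : EReal)) Filter.atTop

/-- `μ` minimizes the average cost among all policies, when the initial state is `s₀`. -/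
def IsCostOptimal (p : unitInterval) (C : ℝ) (s₀ : State) (μ : Policy) : Prop :=
  ∀ ν : Policy, averageCost p C μ s₀ ≤ averageCost p C ν s₀

theorem law_support_finite (p : unitInterval) (μ : Policy) (s₀ : State) (t : ℕ) :
    (law p μ s₀ t).support.Finite := by
  induction t with
  | zero => simp [law]
  | succ t ih =>
    rw [law, PMF.support_bind]
    refine ih.biUnion fun hs _ => ?_
    rw [PMF.support_bind]
    refine (Set.toFinite _).biUnion fun a _ => ?_
    rw [PMF.support_map, transition, PMF.support_map]
    exact ((Set.toFinite _).image _).image _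

end AgeMDP

/-!
The proof is a verification argument with an explicit solution of the average-cost optimality
equation. Write `V x` for the relative value of age `x`, averaged over the arrival indicator.

If `V x + g` is the mean over arrivals of the least `cost + V (next age)`, then the cost so far
plus the relative value of the current state minus `g t` is a submartingale under every policy and
a martingale under the greedy one. As the relative value is bounded below, the greedy policy has
average cost at most `g` (`averageCost_le`). For the lower bound (`le_averageCost`) the final
relative value must be negligible against time, at least along a subsequence. The next age
equals the cost just paid up to a bounded term, and `V` grows linearly; so if the average cost were
below `g`, the expected cost of a single slot would grow linearly in time, which contradicts a
finite average.

Solutions exist whenever `p > 0`. For `C ≤ 0` always updating is optimal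
(`exists_solution_of_nonpos`). For `C > 0` the solution belongs to a threshold rule: `V` is
quadratic up to the threshold and affine beyond it (`exists_solution_of_pos`). For `p = 0` there is
a subsolution for every constant `g`, so all policies cost `⊤` (`averageCost_eq_top`).
-/

namespace AgeMDP

/-! ### Expectations under finitely supported laws -/

/-- The expectation of a real function under a discrete law, as a series. Its value is
meaningful for laws of finite support, the only ones it is used for. -/
noncomputable def expect {α : Type*} (q : PMF α) (F : α → ℝ) : ℝ :=
  ∑' x, (q x).toReal * F x

theorem expect_eq_sum {α : Type*} (q : PMF α) (F : α → ℝ) (S : Finset α)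
    (hS : q.support ⊆ S) : expect q F = ∑ x ∈ S, (q x).toReal * F x := by
  refine tsum_eq_sum fun x hx => ?_
  have : q x = 0 := by
    by_contra h
    exact hx (hS ((PMF.mem_support_iff q x).2 h))
  simp [this]

theorem sum_toReal_eq_one {α : Type*} (q : PMF α) (S : Finset α) (hS : q.support ⊆ S) :
    ∑ x ∈ S, (q x).toReal = 1 := by
  rw [← ENNReal.toReal_sum fun x _ => q.apply_ne_top x, ← ENNReal.toReal_one, ← q.tsum_coe,
    tsum_eq_sum]
  intro x hx
  by_contra h
  exact hx (hS ((PMF.mem_support_iff q x).2 h))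

theorem expect_pure {α : Type*} (x : α) (F : α → ℝ) : expect (PMF.pure x) F = F x := by
  rw [expect_eq_sum _ F {x} (by simp)]
  simp

theorem expect_mono {α : Type*} {q : PMF α} (hq : q.support.Finite) {F G : α → ℝ}
    (h : ∀ x, q x ≠ 0 → F x ≤ G x) : expect q F ≤ expect q G := by
  rw [expect_eq_sum q F hq.toFinset (by simp), expect_eq_sum q G hq.toFinset (by simp)]
  refine Finset.sum_le_sum fun x hx => ?_
  have hx' : q x ≠ 0 := by simpa using hx
  exact mul_le_mul_of_nonneg_left (h x hx') ENNReal.toReal_nonneg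

theorem expect_add {α : Type*} {q : PMF α} (hq : q.support.Finite) (F G : α → ℝ) :
    expect q (fun x => F x + G x) = expect q F + expect q G := by
  simp only [expect_eq_sum q _ hq.toFinset (by simp), mul_add, Finset.sum_add_distrib]

theorem expect_mul_left {α : Type*} (q : PMF α) (c : ℝ) (F : α → ℝ) :
    expect q (fun x => c * F x) = c * expect q F := by
  simp only [expect, mul_left_comm _ c, tsum_mul_left]

theorem expect_const {α : Type*} {q : PMF α} (hq : q.support.Finite) (c : ℝ) :
    expect q (fun _ => c) = c := by
  rw [expect_eq_sum q _ hq.toFinset (by simp), ← Finset.sum_mul,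
    sum_toReal_eq_one q _ (by simp), one_mul]

/-- The tower rule. -/
theorem expect_bind {α β : Type*} {q : PMF α} {k : α → PMF β} (hq : q.support.Finite)
    (hk : ∀ x, (k x).support.Finite) (F : β → ℝ) :
    expect (q.bind k) F = expect q fun x => expect (k x) F := by
  classical
  set S := hq.toFinset with hS
  set T : Finset β := S.biUnion fun x => (hk x).toFinset with hT
  have hbind : (q.bind k).support ⊆ T := by
    rw [PMF.support_bind]
    intro y hy
    simpa [hT, hS] using hy
  rw [expect_eq_sum _ F T hbind, expect_eq_sum q _ S (by simp [hS])]
  have hpt : ∀ y, (q.bind k y).toReal = ∑ x ∈ S, (q x).toReal * (k x y).toReal := by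
    intro y
    rw [PMF.bind_apply, tsum_eq_sum (s := S), ENNReal.toReal_sum]
    · simp [ENNReal.toReal_mul]
    · exact fun x _ => ENNReal.mul_ne_top (q.apply_ne_top x) ((k x).apply_ne_top y)
    · intro x hx
      have : q x = 0 := by simpa [hS] using hx
      simp [this]
  simp only [hpt, Finset.sum_mul]
  rw [Finset.sum_comm]
  refine Finset.sum_congr rfl fun x hx => ?_
  rw [expect_eq_sum (k x) F T, Finset.mul_sum]
  · exact Finset.sum_congr rfl fun y _ => mul_assoc _ _ _
  · intro y hy
    exact Finset.mem_coe.2 (Finset.mem_biUnion.2 ⟨x, hx, by simpa using hy⟩)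

theorem expect_map {α β : Type*} {q : PMF α} (hq : q.support.Finite) (f : α → β) (F : β → ℝ) :
    expect (q.map f) F = expect q fun x => F (f x) := by
  rw [← PMF.bind_pure_comp, expect_bind hq (fun x => by simp)]
  simp [expect_pure]

theorem expect_arrival (p : unitInterval) (F : Bool → ℝ) :
    expect (arrival p) F = p * F true + (1 - p) * F false := by
  have h0 : (0 : ℝ) ≤ p := p.2.1
  have h1 : (0 : ℝ) ≤ 1 - p := sub_nonneg.mpr p.2.2
  rw [expect_eq_sum _ F Finset.univ fun _ _ => Finset.mem_coe.2 (Finset.mem_univ _)]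
  simp [arrival, h0, h1]

/-! ### One step of the process -/

/-- The expectation of `H` at age `x` when the arrival indicator is drawn afresh. -/
noncomputable def mean (p : unitInterval) (H : State → ℝ) (x : ℕ+) : ℝ :=
  p * H (x, true) + (1 - p) * H (x, false)

theorem expect_law_succ (p : unitInterval) (μ : Policy) (s₀ : State) (t : ℕ)
    (F : Past × State → ℝ) :
    expect (law p μ s₀ (t + 1)) F = expect (law p μ s₀ t) fun hs => expect (μ hs.1 hs.2) fun a =>
      mean p (fun s' => F ((hs.2, a) :: hs.1, s')) (nextAge hs.2 a) := by
  have hfin : ∀ s a, (transition p s a).support.Finite := fun s a => by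
    rw [transition, PMF.support_map]
    exact (Set.toFinite _).image _
  have hmap : ∀ (hs : Past × State) a, ((transition p hs.2 a).map
      fun s' => ((hs.2, a) :: hs.1, s')).support.Finite := fun hs a => by
    rw [PMF.support_map]
    exact (hfin _ _).image _
  rw [law, expect_bind (law_support_finite p μ s₀ t)]
  · congr 1
    funext hs
    rw [expect_bind (Set.toFinite _) (hmap hs)]
    congr 1
    funext a
    rw [expect_map (hfin _ _), transition, expect_map (Set.toFinite _), expect_arrival, mean]
  · intro hs
    rw [PMF.support_bind]
    exact (Set.toFinite _).biUnion fun a _ => hmap hs a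

/-- One-step comparison: a pointwise inequality between a function of the history up to slot `t`
and the conditional mean of a function of the history up to slot `t + 1` passes to expectations.
Only actions that the policy charges matter. -/
theorem expect_law_le_succ {p : unitInterval} {μ : Policy} {s₀ : State} {t : ℕ}
    {F G : Past × State → ℝ}
    (h : ∀ (w : Past) (s : State) (a : Action), μ w s a ≠ 0 →
      G (w, s) ≤ mean p (fun s' => F ((s, a) :: w, s')) (nextAge s a)) :
    expect (law p μ s₀ t) G ≤ expect (law p μ s₀ (t + 1)) F := by
  rw [expect_law_succ]
  refine expect_mono (law_support_finite p μ s₀ t) fun hs _ => ?_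
  rw [← expect_const (q := μ hs.1 hs.2) (Set.toFinite _) (G hs)]
  exact expect_mono (Set.toFinite _) fun a ha => h hs.1 hs.2 a ha

/-! ### Verification of the average cost -/

/-- The total cost along a past. -/
def pastCost (C : ℝ) (hs : Past × State) : ℝ :=
  (hs.1.map fun sa => cost C sa.1 sa.2).sum

/-- The expected cost incurred before slot `t`. -/
noncomputable def accCost (p : unitInterval) (C : ℝ) (μ : Policy) (s₀ : State) (t : ℕ) : ℝ :=
  expect (law p μ s₀ t) (pastCost C)

theorem expectedTotalCost_eq (p : unitInterval) (C : ℝ) (μ : Policy) (s₀ : State) (T : ℕ) :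
    expectedTotalCost p C μ s₀ T = accCost p C μ s₀ (T + 1) := rfl

theorem pastCost_cons (C : ℝ) (w : Past) (s s' : State) (a : Action) :
    pastCost C ((s, a) :: w, s') = cost C s a + pastCost C (w, s) := by
  simp [pastCost]

/-- If `H` satisfies the Bellman inequality with constant `g`, then
`(cost so far) + H (current state) - g t` is a submartingale under every policy. -/
theorem le_accCost_add {p : unitInterval} {C g : ℝ} {H : State → ℝ}
    (hsub : ∀ s a, H s + g ≤ cost C s a + mean p H (nextAge s a)) (μ : Policy) (s₀ : State)
    (t : ℕ) : H s₀ + g * t ≤ accCost p C μ s₀ t + expect (law p μ s₀ t) (fun hs => H hs.2) := by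
  induction t with
  | zero => simp [accCost, law, expect_pure, pastCost]
  | succ t ih =>
    have key : expect (law p μ s₀ t) (fun hs => (pastCost C hs + H hs.2) + g) ≤
        expect (law p μ s₀ (t + 1)) fun hs => pastCost C hs + H hs.2 := by
      refine expect_law_le_succ fun w s a _ => ?_
      have := hsub s a
      simp only [mean, pastCost_cons] at this ⊢
      linarith
    rw [expect_add (law_support_finite p μ s₀ t), expect_add (law_support_finite p μ s₀ t),
      expect_add (law_support_finite p μ s₀ _), expect_const (law_support_finite p μ s₀ t)] at key
    unfold accCost at ih ⊢
    push_cast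
    linarith

/-- If `H` satisfies the Bellman inequality in the opposite direction along the actions that `μ`
uses, then `(cost so far) + H (current state) - g t` is a supermartingale under `μ`. -/
theorem accCost_add_le {p : unitInterval} {C g : ℝ} {H : State → ℝ} {μ : Policy}
    (hsup : ∀ w s a, μ w s a ≠ 0 → cost C s a + mean p H (nextAge s a) ≤ H s + g) (s₀ : State)
    (t : ℕ) : accCost p C μ s₀ t + expect (law p μ s₀ t) (fun hs => H hs.2) ≤ H s₀ + g * t := by
  induction t with
  | zero => simp [accCost, law, expect_pure, pastCost]
  | succ t ih =>
    have key : expect (law p μ s₀ t) (fun hs => (-1) * (pastCost C hs + H hs.2) + -g) ≤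
        expect (law p μ s₀ (t + 1)) fun hs => (-1) * (pastCost C hs + H hs.2) := by
      refine expect_law_le_succ fun w s a ha => ?_
      have := hsup w s a ha
      simp only [mean, pastCost_cons] at this ⊢
      linarith
    rw [expect_add (law_support_finite p μ s₀ t), expect_mul_left, expect_mul_left,
      expect_add (law_support_finite p μ s₀ t),
      expect_add (law_support_finite p μ s₀ _), expect_const (law_support_finite p μ s₀ t)] at key
    unfold accCost at ih ⊢
    push_cast
    linarith

/-- A linear bound on `H` by the new age is a linear bound by the cost just paid, because the new
age equals the immediate cost up to the charge `C` for updating. -/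
theorem expect_le_accCost_sub {p : unitInterval} {C A B : ℝ} {H : State → ℝ} (hA : 0 ≤ A)
    (hH : ∀ x : ℕ+, mean p H x ≤ A * x + B) (μ : Policy) (s₀ : State) (t : ℕ) :
    expect (law p μ s₀ (t + 1)) (fun hs => H hs.2) ≤
      A * (accCost p C μ s₀ (t + 1) - accCost p C μ s₀ t) + (A * |C| + B) := by
  have key : expect (law p μ s₀ t) (fun hs => A * pastCost C hs + -(A * |C| + B)) ≤
      expect (law p μ s₀ (t + 1)) fun hs => A * pastCost C hs + (-1) * H hs.2 := by
    refine expect_law_le_succ fun w s a _ => ?_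
    have h1 := hH (nextAge s a)
    have h2 : ((nextAge s a : ℕ+) : ℝ) ≤ cost C s a + |C| := by
      have := neg_abs_le C
      have := abs_nonneg C
      rcases s with ⟨x, l⟩
      cases l <;> cases a <;> simp [nextAge, cost] <;> linarith
    have h3 := mul_le_mul_of_nonneg_left h2 hA
    simp only [mean, pastCost_cons] at h1 ⊢
    linarith
  rw [expect_add (law_support_finite p μ s₀ t), expect_mul_left,
    expect_add (law_support_finite p μ s₀ _), expect_const (law_support_finite p μ s₀ t),
    expect_mul_left, expect_mul_left] at key
  unfold accCost
  linarith

/-- Verification, lower bound: a solution of the Bellman inequality that grows at most linearly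
in the age bounds the average cost of every policy from below. -/
theorem le_averageCost {p : unitInterval} {C g A B : ℝ} {H : State → ℝ} (hA : 0 < A)
    (hsub : ∀ s a, H s + g ≤ cost C s a + mean p H (nextAge s a))
    (hH : ∀ x : ℕ+, mean p H x ≤ A * x + B) (μ : Policy) (s₀ : State) :
    (g : EReal) ≤ averageCost p C μ s₀ := by
  by_contra! hlt
  obtain ⟨r, hr, hrg⟩ := EReal.lt_iff_exists_real_btwn.1 hlt
  have hrg' : r < g := by exact_mod_cast hrg
  set S := accCost p C μ s₀ with hS
  have hev : ∀ᶠ T : ℕ in Filter.atTop, S (T + 1) < r * (T + 1) := by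
    filter_upwards [Filter.eventually_lt_of_limsup_lt hr] with T hT
    have hT' : 1 / ((T : ℝ) + 1) * S (T + 1) < r := by
      rw [hS, ← expectedTotalCost_eq]; exact_mod_cast hT
    rwa [one_div, inv_mul_lt_iff₀ (by positivity), mul_comm] at hT'
  -- The total cost stays below `r (T + 1)`, hence `E H` grows linearly, hence so does the
  -- expected cost of a single slot.
  have hinc : ∀ᶠ T : ℕ in Filter.atTop, S T + (r + 1) ≤ S (T + 1) := by
    have hlin : ∀ᶠ T : ℕ in Filter.atTop,
        (A * (r + 1) + (A * |C| + B) - H s₀) / (g - r) ≤ (T : ℝ) :=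
      tendsto_natCast_atTop_atTop.eventually_ge_atTop _
    filter_upwards [hev, hlin] with T h1 h2
    rw [div_le_iff₀ (by linarith)] at h2
    have h3 := le_accCost_add hsub μ s₀ (T + 1)
    have h4 := expect_le_accCost_sub (C := C) hA.le hH μ s₀ T
    push_cast at h3
    rw [← hS] at h3 h4
    have h5 : A * (r + 1) ≤ A * (S (T + 1) - S T) := by nlinarith
    have := le_of_mul_le_mul_left h5 hA
    linarith
  obtain ⟨N, hN⟩ := Filter.eventually_atTop.1 hinc
  have hgrow : ∀ k : ℕ, S N + (r + 1) * k ≤ S (N + k) := by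
    intro k
    induction k with
    | zero => simp
    | succ k ih =>
      have := hN (N + k) (by omega)
      rw [← add_assoc]
      push_cast
      linarith
  obtain ⟨M, hM⟩ := Filter.eventually_atTop.1 hev
  obtain ⟨k, hk⟩ := exists_nat_ge (r * N - S N)
  have h1 := hgrow (k + M + 1)
  have h2 := hM (N + (k + M)) (by omega)
  rw [show N + (k + M + 1) = N + (k + M) + 1 by ring] at h1
  push_cast at h1 h2
  have : (0 : ℝ) ≤ M := M.cast_nonneg
  nlinarith

/-- Verification, upper bound: a policy whose actions attain the Bellman equation with a function
bounded below has average cost at most `g`. -/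
theorem averageCost_le {p : unitInterval} {C g K : ℝ} {H : State → ℝ} {μ : Policy}
    (hsup : ∀ w s a, μ w s a ≠ 0 → cost C s a + mean p H (nextAge s a) ≤ H s + g)
    (hK : ∀ s, K ≤ H s) (s₀ : State) : averageCost p C μ s₀ ≤ g := by
  have hle : ∀ T : ℕ, 1 / ((T : ℝ) + 1) * expectedTotalCost p C μ s₀ T ≤
      g + (H s₀ - K) * (1 / ((T : ℝ) + 1)) := by
    intro T
    have h1 := accCost_add_le hsup s₀ (T + 1)
    have h2 : K ≤ expect (law p μ s₀ (T + 1)) fun hs => H hs.2 := by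
      rw [← expect_const (law_support_finite p μ s₀ (T + 1)) K]
      exact expect_mono (law_support_finite p μ s₀ _) fun hs _ => hK hs.2
    rw [expectedTotalCost_eq]
    push_cast at h1
    have hT : (0 : ℝ) < (T : ℝ) + 1 := by positivity
    have h3 : accCost p C μ s₀ (T + 1) ≤ g * (T + 1) + (H s₀ - K) := by linarith
    calc 1 / ((T : ℝ) + 1) * accCost p C μ s₀ (T + 1)
        ≤ 1 / ((T : ℝ) + 1) * (g * (T + 1) + (H s₀ - K)) := by gcongr
      _ = g + (H s₀ - K) * (1 / ((T : ℝ) + 1)) := by field_simp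
  have hlim : Filter.Tendsto (fun T : ℕ => ((g + (H s₀ - K) * (1 / ((T : ℝ) + 1)) : ℝ) : EReal))
      Filter.atTop (nhds (g : EReal)) := by
    refine EReal.tendsto_coe.2 ?_
    simpa using (tendsto_one_div_add_atTop_nhds_zero_nat (𝕜 := ℝ)).const_mul (H s₀ - K)
      |>.const_add g
  rw [averageCost, ← hlim.limsup_eq]
  exact Filter.limsup_le_limsup (Filter.Eventually.of_forall fun T => EReal.coe_le_coe (hle T))

/-! ### The greedy policy -/

/-- The cost of action `a` in state `s` plus the relative value `V` of the age it leads to. -/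
noncomputable def actionValue (C : ℝ) (V : ℕ+ → ℝ) (s : State) (a : Action) : ℝ :=
  cost C s a + V (nextAge s a)

/-- The policy that minimizes `actionValue`, updating in case of a tie. -/
noncomputable def greedy (C : ℝ) (V : ℕ+ → ℝ) : Policy := fun _ s =>
  open Classical in
  PMF.pure (decide (actionValue C V s true ≤ actionValue C V s false))

/-- The minimum of `actionValue` over the two actions. -/
noncomputable def bellman (C : ℝ) (V : ℕ+ → ℝ) (s : State) : ℝ :=
  min (actionValue C V s true) (actionValue C V s false)

/-- If the relative value `V` of the age solves the average-cost optimality equation, is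
nonnegative and grows at most linearly, then the greedy policy is optimal from every state. -/
theorem isCostOptimal_greedy {p : unitInterval} {C g A B : ℝ} {V : ℕ+ → ℝ} (hA : 0 < A)
    (hV : ∀ x, V x + g = mean p (bellman C V) x) (hV0 : ∀ x, 0 ≤ V x)
    (hVA : ∀ x : ℕ+, V x ≤ A * x + B) (s₀ : State) :
    IsCostOptimal p C s₀ (greedy C V) := by
  have hmean : ∀ x, mean p (fun s => bellman C V s - g) x = V x := by
    intro x
    have := hV x
    simp only [mean] at this ⊢
    linarith
  intro ν
  refine (averageCost_le (g := g) (H := fun s => bellman C V s - g) (K := -|C| - g) ?_ ?_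
    s₀).trans (le_averageCost (H := fun s => bellman C V s - g) (A := A) (B := B) hA ?_ ?_ ν s₀)
  · intro w s a ha
    rw [hmean, sub_add_cancel]
    change actionValue C V s a ≤ _
    have ha' : a = decide (actionValue C V s true ≤ actionValue C V s false) := by
      by_contra h
      exact ha (PMF.pure_apply_of_ne _ _ h)
    by_cases h : actionValue C V s true ≤ actionValue C V s false
    · simp [ha', h, bellman]
    · simp [ha', h, bellman, le_of_not_ge h]
  · intro s
    have hc : ∀ a, -|C| ≤ actionValue C V s a := by
      intro a
      have h1 := hV0 (nextAge s a)
      have h2 := neg_abs_le C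
      have h3 := abs_nonneg C
      rcases s with ⟨x, l⟩
      have h4 : (0 : ℝ) ≤ x := Nat.cast_nonneg _
      cases l <;> cases a <;> simp [actionValue, cost] <;> linarith
    have := le_min (hc true) (hc false)
    simpa [bellman] using this
  · intro s a
    rw [hmean, sub_add_cancel]
    cases a
    · exact min_le_right _ _
    · exact min_le_left _ _
  · intro x
    rw [hmean]
    exact hVA x

theorem greedy_isStationary (C : ℝ) (V : ℕ+ → ℝ) : IsStationary (greedy C V) := by
  rintro _ _ s _ rfl
  rfl

theorem greedy_isDeterministic (C : ℝ) (V : ℕ+ → ℝ) : IsDeterministic (greedy C V) :=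
  fun _ _ => ⟨_, rfl⟩

theorem mean_bellman (p : unitInterval) (C : ℝ) (V : ℕ+ → ℝ) (x : ℕ+) :
    mean p (bellman C V) x = p * min (1 + C + V 1) (x + 1 + V (x + 1)) +
      (1 - p) * min (x + 1 + C + V (x + 1)) (x + 1 + V (x + 1)) := by
  simp [mean, bellman, actionValue, cost, nextAge]

/-! ### Solutions of the optimality equation -/

/-- Without arrivals every policy has infinite average cost: the quadratic
`(|C| + g) x - x² / 2` solves the Bellman inequality for every constant `g`. -/
theorem averageCost_eq_top {p : unitInterval} (hp : (p : ℝ) = 0) (C : ℝ) (μ : Policy)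
    (s₀ : State) : averageCost p C μ s₀ = ⊤ := by
  refine EReal.eq_top_iff_forall_lt _ |>.2 fun y => ?_
  refine lt_of_lt_of_le (b := ((y + 1 : ℝ) : EReal)) (by exact_mod_cast lt_add_one y) ?_
  set g := y + 1
  let V : ℕ+ → ℝ := fun x => (|C| + g) * x - (x : ℝ) ^ 2 / 2
  -- Arrivals have probability zero, so any small enough value will do after one.
  let H : State → ℝ := fun s =>
    if s.2 then min (V s.1) (V 1 + 1 - |C| - g) else V s.1
  have hmean : ∀ x, mean p H x = V x := by
    intro x
    simp [mean, H, hp]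
  have hC := neg_abs_le C
  have hC' := abs_nonneg C
  have hstep : ∀ x, V x + g ≤ x + 1 - |C| + V (x + 1) := by
    intro x
    simp only [V]
    push_cast
    nlinarith
  refine le_averageCost (H := H) (A := |(|C| + g)| + 1) (B := 0) (by positivity) ?_ ?_ μ s₀
  · rintro ⟨x, l⟩ a
    rw [hmean]
    have h1 := hstep x
    have h2 := min_le_left (V x) (V 1 + 1 - |C| - g)
    have h3 := min_le_right (V x) (V 1 + 1 - |C| - g)
    cases l <;> cases a <;> simp [H, cost, nextAge] <;> linarith
  · intro x
    rw [hmean]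
    have h1 := le_abs_self (|C| + g)
    have h4 : (0 : ℝ) ≤ x := Nat.cast_nonneg _
    simp only [V]
    nlinarith

/-- When updating is free or rewarded, always updating is optimal, with relative value
`(1 - p) / p * (x - 1)` and average cost `C + 1 / p`. -/
theorem exists_solution_of_nonpos {p : unitInterval} {C : ℝ} (hp : 0 < (p : ℝ)) (hC : C ≤ 0) :
    ∃ (g A B : ℝ) (V : ℕ+ → ℝ), 0 < A ∧ (∀ x, V x + g = mean p (bellman C V) x) ∧
      (∀ x, 0 ≤ V x) ∧ ∀ x : ℕ+, V x ≤ A * x + B := by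
  have hp1 : (p : ℝ) ≤ 1 := p.2.2
  set α : ℝ := (1 - p) / p with hα
  have hα0 : 0 ≤ α := div_nonneg (by linarith) hp.le
  have hx : ∀ x : ℕ+, (1 : ℝ) ≤ x := fun x => by exact_mod_cast one_le (a := x)
  refine ⟨C + 1 / p, α + 1, 0, fun x => α * (x - 1), by positivity, fun x => ?_, fun x => ?_,
    fun x => ?_⟩
  · have h1 := hx x
    have h2 : 0 ≤ α * x := by positivity
    rw [mean_bellman]
    push_cast
    rw [min_eq_left (by linarith), min_eq_left (by linarith), hα]
    field_simp
    ring
  · exact mul_nonneg hα0 (by linarith [hx x])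
  · nlinarith [hx x]

/-- When updating costs `C > 0`, a threshold rule is optimal: update when a packet has arrived
and the age is at least `n`. The threshold `n` and the average cost `g` are pinned down by
`n - 1 + 1 / p < g ≤ n + 1 / p` and by equality of the two branches of `V` at `n`. -/
theorem exists_solution_of_pos {p : unitInterval} {C : ℝ} (hp : 0 < (p : ℝ)) (hC : 0 < C) :
    ∃ (g A B : ℝ) (V : ℕ+ → ℝ), 0 < A ∧ (∀ x, V x + g = mean p (bellman C V) x) ∧
      (∀ x, 0 ≤ V x) ∧ ∀ x : ℕ+, V x ≤ A * x + B := by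
  have hp1 : (p : ℝ) ≤ 1 := p.2.2
  set α : ℝ := (1 - p) / p with hα
  have hα0 : 0 ≤ α := div_nonneg (by linarith) hp.le
  have hpα : (p : ℝ) * α = 1 - p := by rw [hα]; field_simp
  -- `L n` is the charge at which the thresholds `n` and `n + 1` are both optimal.
  let L : ℕ → ℝ := fun n => (n : ℝ) ^ 2 / 2 + n / 2 + α * n
  have hL : ∃ n, C ≤ L n := by
    obtain ⟨n, hn⟩ := exists_nat_ge (2 * C)
    refine ⟨n, ?_⟩
    have : (0 : ℝ) ≤ α * n := by positivity
    simp only [L]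
    nlinarith
  obtain ⟨m, hm1, hm2⟩ : ∃ m, L m < C ∧ C ≤ L (m + 1) := by
    classical
    have hpos : Nat.find hL ≠ 0 := by
      intro h
      have := Nat.find_spec hL
      rw [h] at this
      simp [L] at this
      linarith
    obtain ⟨m, hm⟩ := Nat.exists_eq_succ_of_ne_zero hpos
    exact ⟨m, not_le.1 (Nat.find_min hL (by omega)), by simpa [hm] using Nat.find_spec hL⟩
  set n : ℝ := (m : ℝ) + 1 with hn
  have hn1 : 1 ≤ n := by simp [hn]
  have hnα : 0 < n + α := by linarith
  -- `d = n + 1 / p - g` measures how far the average cost is below its largest value for `n`.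
  obtain ⟨d, hd⟩ : ∃ d, (n + α) * d = L (m + 1) - C := ⟨_, mul_div_cancel₀ _ hnα.ne'⟩
  have hd0 : 0 ≤ d := by
    by_contra! h
    nlinarith
  have hd1 : d < 1 := by
    have : L (m + 1) - L m = n + α := by
      simp only [L, hn]; push_cast; ring
    by_contra! h
    nlinarith
  set g : ℝ := n + 1 + α - d with hg
  have hCd : C = n ^ 2 / 2 + n / 2 + α * n - (n + α) * d := by
    rw [hd]; simp only [L, hn]; push_cast; ring
  set β : ℝ := (d - n - 1) * (1 + α) + 1 + C with hβ
  let V : ℕ+ → ℝ := fun x =>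
    if (x : ℕ) ≤ m then ((x : ℝ) - 1) * (g - 1 - x / 2) else α * x + β
  have hx1 : ∀ x : ℕ+, (1 : ℝ) ≤ x := fun x => by exact_mod_cast one_le (a := x)
  have hlow : ∀ x : ℕ+, (x : ℕ) ≤ m + 1 → V x = ((x : ℝ) - 1) * (g - 1 - x / 2) := by
    intro x hx
    rcases hx.eq_or_lt with h | h
    · have hxn : (x : ℝ) = n := by rw [h, hn]; push_cast; rfl
      simp only [V, h, Nat.not_succ_le_self, if_false]
      rw [← h, hxn, hβ, hCd, hg]
      ring
    · simp [V, Nat.lt_succ_iff.1 h]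
  have hhigh : ∀ x : ℕ+, m < (x : ℕ) → V x = α * x + β := fun x hx => by
    simp [V, not_le.2 hx]
  have hV1 : V 1 = 0 := by
    rw [hlow 1 (by simp)]; simp
  have hV0 : ∀ x, 0 ≤ V x := by
    have hV0_low : ∀ x : ℕ+, (x : ℕ) ≤ m + 1 → 0 ≤ V x := by
      intro x hx
      rw [hlow x hx]
      have hxn : (x : ℝ) ≤ n := by rw [hn]; exact_mod_cast hx
      rcases (hx1 x).eq_or_lt with h | h
      · simp [← h]
      · have hx2 : (2 : ℝ) ≤ x := by
          have : 1 < (x : ℕ) := by exact_mod_cast h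
          exact_mod_cast this
        exact mul_nonneg (by linarith) (by linarith)
    intro x
    rcases le_or_gt (x : ℕ) m with h | h
    · exact hV0_low x (by omega)
    · have h1 := hV0_low m.succPNat le_rfl
      rw [hhigh m.succPNat (Nat.lt_succ_self m)] at h1
      rw [hhigh x h]
      have h2 : n ≤ (x : ℝ) := by rw [hn]; exact_mod_cast h
      have h3 : ((m.succPNat : ℕ) : ℝ) = n := by simp [hn]
      rw [h3] at h1
      nlinarith
  refine ⟨g, |g| + α + |β| + 1, |β|, V, by positivity, fun x => ?_, hV0, fun x => ?_⟩
  · rw [mean_bellman, hV1, min_eq_right (a := (x : ℝ) + 1 + C + V (x + 1)) (by linarith)]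
    rcases le_or_gt (x : ℕ) m with h | h
    · have hxn : (x : ℝ) ≤ n - 1 := by
        rw [hn, add_sub_cancel_right]; exact_mod_cast h
      rw [hlow x (by omega), hlow (x + 1) (by simpa using h)]
      push_cast
      -- Idling has the advantage `C - (x g - x (x + 1) / 2)`, which decreases up to age `n - 1`.
      have hidle : (x : ℝ) * g - x * (x + 1) / 2 ≤ C := by
        have h1 : 0 ≤ (n - 1 - x) * (g - (n + x) / 2) :=
          mul_nonneg (by linarith) (by linarith)
        have h2 : C - ((n - 1) * g - (n - 1) * n / 2) = (1 + α) * (1 - d) := by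
          rw [hCd, hg]; ring
        have h3 : 0 ≤ (1 + α) * (1 - d) := mul_nonneg (by linarith) (by linarith)
        nlinarith
      rw [min_eq_right (by linarith)]
      ring
    · have hxn : n ≤ (x : ℝ) := by rw [hn]; exact_mod_cast h
      rw [hhigh x h, hhigh (x + 1) (by simp; omega)]
      push_cast
      have hupdate : 0 ≤ (1 + α) * (x + d - n) := mul_nonneg (by linarith) (by linarith)
      have hpα' : (p : ℝ) * (1 + α) = 1 := by linarith
      rw [min_eq_left (by rw [hβ]; linarith), hβ, hg]
      linear_combination (x + d - n) * hpα'
  · have h1 := hx1 x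
    have hg1 := le_abs_self g
    have hg2 := abs_nonneg g
    have hβ1 := le_abs_self β
    have hβ2 := abs_nonneg β
    have h2 : 0 ≤ α * x := by positivity
    have h3 : 0 ≤ |β| * x := by positivity
    rcases le_or_gt (x : ℕ) m with h | h
    · rw [hlow x (by omega)]
      have h4 : ((x : ℝ) - 1) * (g - 1 - x / 2) ≤ (x - 1) * |g| :=
        mul_le_mul_of_nonneg_left (by linarith) (by linarith)
      nlinarith
    · rw [hhigh x h]
      nlinarith

end AgeMDP

/-- There is one stationary deterministic policy that is cost-optimal for every initial state. -/
theorem theorem1 (p : unitInterval) (C : ℝ) :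
    ∃ μ : AgeMDP.Policy, AgeMDP.IsStationary μ ∧ AgeMDP.IsDeterministic μ ∧
      ∀ s₀ : AgeMDP.State, AgeMDP.IsCostOptimal p C s₀ μ := by
  rcases p.2.1.eq_or_lt with hp | hp
  · refine ⟨AgeMDP.greedy C 0, AgeMDP.greedy_isStationary C 0, AgeMDP.greedy_isDeterministic C 0,
      fun s₀ ν => ?_⟩
    rw [AgeMDP.averageCost_eq_top hp.symm C ν s₀]
    exact le_top
  · obtain ⟨g, A, B, V, hA, hV, hV0, hVA⟩ : ∃ (g A B : ℝ) (V : ℕ+ → ℝ), 0 < A ∧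
        (∀ x, V x + g = AgeMDP.mean p (AgeMDP.bellman C V) x) ∧ (∀ x, 0 ≤ V x) ∧
        ∀ x : ℕ+, V x ≤ A * x + B := by
      rcases le_or_gt C 0 with hC | hC
      · exact AgeMDP.exists_solution_of_nonpos hp hC
      · exact AgeMDP.exists_solution_of_pos hp hC
    exact ⟨AgeMDP.greedy C V, AgeMDP.greedy_isStationary C V, AgeMDP.greedy_isDeterministic C V,
      AgeMDP.isCostOptimal_greedy hA hV hV0 hVA⟩
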